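/- Let $M$ be a smooth manifold modelled on a convenient vector space (a Hausdorff, locally convex, Mackey-complete real topological vector space; this includes Fréchet and Banach manifolds), with kinematic tangent bundle $TM$ and cotangent bundle $T'M$; here $T'_pM$ consists of the bounded linear functionals on $T_pM$ (for Fréchet and Banach manifolds: the continuous ones). Let $\theta,\eta$ be smooth 1-forms on $M$ with $d\theta=0$. For $p\in M$ put \[ H_t=\ker\theta_p,\quad H_z=\ker\eta_p,\quad H_{tz}=H_t\cap H_z,\quad V=\ker d\eta_p=\{v\in T_pM : d\eta_p(v,\cdot)=0\},\quad V_t=V\cap H_z,\quad V_z=V\cap H_t . \] Assume that $d\eta$ is degenerate on $\ker\theta$ and on $\ker\eta$, in the sense that at every $p\in M$ the map $v\mapsto \iota_v d\eta$ restricted to $H_t$, respectively to $H_z$, has non-zero kernel, i.e. $V_z\neq 0$ and $V_t\neq 0$. Then the following are equivalent: 1. $T_pM=H_{tz}\oplus V_t\oplus V_z$ (direct sum of vector spaces) for every $p\in M$. 2. $(\ker\theta\cap\ker\eta,\ d\eta)$ is a weakly symplectic distribution: for every $p\in M$, if $v\in H_{tz}$ and $d\eta_p(v,w)=0$ for all $w\in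 H_{tz}$, then $v=0$. 3. The bundle morphism $\flat_{\theta,\eta}\colon TM\to T'M$, $v\mapsto \theta(v)\theta+\iota_v d\eta+\eta(v)\eta$, is injective. -/

import Mathlib

open Set Filter Topology

/-! Calculus and differential forms on manifolds modelled on convenient vector spaces. -/

namespace Convenient

section Calculus

variable {E F G : Type*}
  [AddCommGroup E] [Module ℝ E] [TopologicalSpace E]
  [AddCommGroup F] [Module ℝ F] [TopologicalSpace F]
  [AddCommGroup G] [Module ℝ G] [TopologicalSpace G]

/-- The curve `c` in a topological vector space has derivative `v` at time `t`:
the difference quotients `(c (t + δ) - c t) / δ` tend to `v` as `δ → 0`, `δ ≠ 0`. -/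
def HasVelocityAt (c : ℝ → E) (v : E) (t : ℝ) : Prop :=
  Tendsto (fun δ : ℝ => δ⁻¹ • (c (t + δ) - c t)) (𝓝[≠] 0) (𝓝 v)

/-- The derivative of a curve at time `t` (meaningful when the curve is differentiable there). -/
noncomputable def velocity (c : ℝ → E) (t : ℝ) : E :=
  haveI : Nonempty E := ⟨0⟩
  limUnder (𝓝[≠] (0 : ℝ)) fun δ : ℝ => δ⁻¹ • (c (t + δ) - c t)

theorem HasVelocityAt.velocity_eq [T2Space E] {c : ℝ → E} {v : E} {t : ℝ}
    (h : HasVelocityAt c v t) : velocity c t = v :=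
  Tendsto.limUnder_eq h

/-- The curve `c` is smooth on the open set `J` of times: all its iterated derivatives
`d 0 = c, d 1, d 2, …` exist and are continuous there. -/
def SmoothCurveOn (c : ℝ → E) (J : Set ℝ) : Prop :=
  ∃ d : ℕ → ℝ → E, (∀ t ∈ J, d 0 t = c t) ∧
    ∀ n, ContinuousOn (d n) J ∧ ∀ t ∈ J, HasVelocityAt (d n) (d (n + 1) t) t

/-- A convenient vector space: a Hausdorff locally convex real topological vector space in
which every smooth curve `ℝ → E` is the derivative of a smooth curve. -/
class ConvenientSpace (E : Type*) [AddCommGroup E] [Module ℝ E] [TopologicalSpace E] : Prop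
    extends IsTopologicalAddGroup E, ContinuousSMul ℝ E, T2Space E, LocallyConvexSpace ℝ E where
  exists_antiderivative : ∀ c₁ : ℝ → E, SmoothCurveOn c₁ univ →
    ∃ c₂ : ℝ → E, SmoothCurveOn c₂ univ ∧ ∀ t, HasVelocityAt c₂ (c₁ t) t

/-- A map is smooth on the open set `U` if it takes smooth curves in `U` to smooth curves.
(Curves defined on open sets of times are allowed; since smoothness of a curve is local and
curves may be reparametrised, testing on curves `ℝ → U` only gives the same notion.) -/
def SmoothMapOn (f : E → F) (U : Set E) : Prop :=
  ∀ (c : ℝ → E) (J : Set ℝ), IsOpen J → SmoothCurveOn c J → MapsTo c J U →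
    SmoothCurveOn (f ∘ c) J

/-- `SmoothMapOn` for real-valued functions, with Mathlib's smoothness of the real function
`f ∘ c` of a real variable. -/
def SmoothFunOn (f : E → ℝ) (U : Set E) : Prop :=
  ∀ (c : ℝ → E) (J : Set ℝ), IsOpen J → SmoothCurveOn c J → MapsTo c J U →
    ContDiffOn ℝ (⊤ : ℕ∞) (f ∘ c) J

theorem SmoothFunOn.add {f g : E → ℝ} {U : Set E} (hf : SmoothFunOn f U)
    (hg : SmoothFunOn g U) : SmoothFunOn (fun x => f x + g x) U :=
  fun c J hJ hc hU => (hf c J hJ hc hU).add (hg c J hJ hc hU)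

theorem SmoothFunOn.mul {f g : E → ℝ} {U : Set E} (hf : SmoothFunOn f U)
    (hg : SmoothFunOn g U) : SmoothFunOn (fun x => f x * g x) U :=
  fun c J hJ hc hU => (hf c J hJ hc hU).mul (hg c J hJ hc hU)

theorem smoothFunOn_zero {U : Set E} : SmoothFunOn (fun _ : E => (0 : ℝ)) U :=
  fun _ _ _ _ _ => contDiffOn_const

theorem HasVelocityAt.fst {c : ℝ → E × F} {v : E × F} {t : ℝ} (h : HasVelocityAt c v t) :
    HasVelocityAt (fun s => (c s).1) v.1 t :=
  (continuous_fst.tendsto v).comp h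

theorem HasVelocityAt.snd {c : ℝ → E × F} {v : E × F} {t : ℝ} (h : HasVelocityAt c v t) :
    HasVelocityAt (fun s => (c s).2) v.2 t :=
  (continuous_snd.tendsto v).comp h

theorem HasVelocityAt.prodMk {c : ℝ → E} {c' : ℝ → F} {v : E} {v' : F} {t : ℝ}
    (h : HasVelocityAt c v t) (h' : HasVelocityAt c' v' t) :
    HasVelocityAt (fun s => (c s, c' s)) (v, v') t :=
  Tendsto.prodMk_nhds h h'

theorem SmoothCurveOn.fst {c : ℝ → E × F} {J : Set ℝ} (h : SmoothCurveOn c J) :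
    SmoothCurveOn (fun s => (c s).1) J := by
  obtain ⟨d, h0, hd⟩ := h
  exact ⟨fun n s => (d n s).1, fun t ht => by simp [h0 t ht], fun n =>
    ⟨continuous_fst.comp_continuousOn (hd n).1, fun t ht => ((hd n).2 t ht).fst⟩⟩

theorem SmoothCurveOn.snd {c : ℝ → E × F} {J : Set ℝ} (h : SmoothCurveOn c J) :
    SmoothCurveOn (fun s => (c s).2) J := by
  obtain ⟨d, h0, hd⟩ := h
  exact ⟨fun n s => (d n s).2, fun t ht => by simp [h0 t ht], fun n =>
    ⟨continuous_snd.comp_continuousOn (hd n).1, fun t ht => ((hd n).2 t ht).snd⟩⟩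

theorem SmoothCurveOn.prodMk {c : ℝ → E} {c' : ℝ → F} {J : Set ℝ}
    (h : SmoothCurveOn c J) (h' : SmoothCurveOn c' J) :
    SmoothCurveOn (fun s => (c s, c' s)) J := by
  obtain ⟨d, h0, hd⟩ := h
  obtain ⟨d', h0', hd'⟩ := h'
  exact ⟨fun n s => (d n s, d' n s), fun t ht => by simp [h0 t ht, h0' t ht], fun n =>
    ⟨(hd n).1.prodMk (hd' n).1, fun t ht => ((hd n).2 t ht).prodMk ((hd' n).2 t ht)⟩⟩

theorem smoothCurveOn_const (x : E) (J : Set ℝ) : SmoothCurveOn (fun _ => x) J := by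
  refine ⟨fun n _ => if n = 0 then x else 0, fun t _ => by simp, fun n =>
    ⟨continuousOn_const, fun t _ => ?_⟩⟩
  simpa [HasVelocityAt] using tendsto_const_nhds

end Calculus

section Manifold

set_option linter.unusedSectionVars false

variable (E : Type*) [AddCommGroup E] [Module ℝ E] [TopologicalSpace E]
variable (M : Type*) [TopologicalSpace M] [ChartedSpace E M]

/-- A manifold modelled on the convenient vector space `E`: the changes of charts of the
atlas are smooth where they are defined. -/
class ConvenientManifold : Prop where
  smooth_transition : ∀ e ∈ atlas E M, ∀ e' ∈ atlas E M,
    SmoothMapOn (fun y => e' (e.symm y)) (e.target ∩ e.symm ⁻¹' e'.source)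

variable {M}

/-- The kinematic tangent space at `p`. The class of a smooth curve `c` through `p = c 0` is
represented by the velocity of `chartAt E p ∘ c` at time `0`; this identifies the space of
classes with the model space `E`, with its linear structure. -/
abbrev KTangent (_p : M) : Type _ := E

/-- The kinematic cotangent space at `p`: the linear functionals on the tangent space that take
smooth curves to smooth functions. These are exactly the bounded linear functionals; if `E` is
bornological (such as a Fréchet or Banach space), exactly the continuous ones. -/
def KCotangent (p : M) : Submodule ℝ (KTangent E p →ₗ[ℝ] ℝ) where
  carrier := {l | SmoothFunOn (fun v : E => l v) univ}
  add_mem' := fun ha hb => ha.add hb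
  zero_mem' := smoothFunOn_zero
  smul_mem' := fun _ _ hl c J hJ hc hU => contDiffOn_const.smul (hl c J hJ hc hU)

variable {E}

/-- For `y` in the target of the chart `e`, the tangent vector at `e.symm y` whose coordinate
expression in the chart `e` is `v`, i.e. the class of the curve `t ↦ e.symm (y + t v)`. -/
noncomputable def ofChart (e : OpenPartialHomeomorph M E) (y v : E) :
    KTangent E (e.symm y) :=
  velocity (fun t : ℝ => chartAt E (e.symm y) (e.symm (y + t • v))) 0

theorem hasVelocityAt_self_chart [IsTopologicalAddGroup E] [ContinuousSMul ℝ E]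
    (e : OpenPartialHomeomorph M E) {y : E} (hy : y ∈ e.target) (v : E) :
    HasVelocityAt (fun t : ℝ => e (e.symm (y + t • v))) v 0 := by
  have hc : Tendsto (fun δ : ℝ => y + δ • v) (𝓝[≠] 0) (𝓝 y) := by
    have : Continuous fun δ : ℝ => y + δ • v := by fun_prop
    simpa using (this.tendsto 0).mono_left nhdsWithin_le_nhds
  have hev := hc.eventually (e.open_target.mem_nhds hy)
  refine Tendsto.congr' ?_ tendsto_const_nhds
  filter_upwards [hev, self_mem_nhdsWithin] with δ hδ h0
  simp only [zero_add, zero_smul, add_zero]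
  rw [e.right_inv hδ, e.right_inv hy, add_sub_cancel_left, smul_smul,
    inv_mul_cancel₀ h0, one_smul]

theorem ofChart_chartAt [IsTopologicalAddGroup E] [ContinuousSMul ℝ E] [T2Space E]
    (p : M) (v : E) : ofChart (chartAt E p) (chartAt E p p) v = v := by
  have h := hasVelocityAt_self_chart (chartAt E p) (mem_chart_target E p) v
  have hp : (chartAt E p).symm (chartAt E p p) = p :=
    (chartAt E p).left_inv (mem_chart_source E p)
  unfold ofChart
  rw [hp]
  exact h.velocity_eq

variable (E M)

/-- A (kinematic) 1-form: a family of linear functionals on the tangent spaces which is smooth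
as a function on the tangent bundle, i.e. whose coordinate expression
`(y, v) ↦ α_y(v)` in every chart is smooth. -/
@[ext]
structure OneForm where
  toFun : ∀ p : M, KTangent E p →ₗ[ℝ] ℝ
  smooth : ∀ e ∈ atlas E M,
    SmoothFunOn (fun z : E × E => toFun (e.symm z.1) (ofChart e z.1 z.2)) (e.target ×ˢ univ)

/-- A (kinematic) 2-form: a family of alternating bilinear forms on the tangent spaces whose
coordinate expression `(y, v, w) ↦ ω_y(v, w)` in every chart is smooth. -/
@[ext]
structure TwoForm where
  toFun : ∀ p : M, KTangent E p →ₗ[ℝ] KTangent E p →ₗ[ℝ] ℝ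
  alternating : ∀ p v, toFun p v v = 0
  smooth : ∀ e ∈ atlas E M,
    SmoothFunOn (fun z : E × E × E =>
      toFun (e.symm z.1) (ofChart e z.1 z.2.1) (ofChart e z.1 z.2.2)) (e.target ×ˢ univ)

/-- A morphism of vector bundles from the tangent bundle to the cotangent bundle, over the
identity of `M`: a family of linear maps of the fibres, smooth in every chart (a map into a
space of functionals is smooth when it is smooth jointly with the argument `w`). -/
structure BundleMorphism where
  toFun : ∀ p : M, KTangent E p →ₗ[ℝ] KCotangent E p
  smooth : ∀ e ∈ atlas E M,
    SmoothFunOn (fun z : E × E × E =>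
      (toFun (e.symm z.1) (ofChart e z.1 z.2.1)).1 (ofChart e z.1 z.2.2)) (e.target ×ˢ univ)

variable {E M}

/-- The underlying map of total spaces `TM → T'M`. -/
def BundleMorphism.onTotal (Φ : BundleMorphism E M) :
    (Σ p : M, KTangent E p) → Σ p : M, KCotangent E p :=
  fun x => ⟨x.1, Φ.toFun x.1 x.2⟩

instance : Zero (TwoForm E M) :=
  ⟨{ toFun := fun _ => 0
     alternating := fun _ _ => rfl
     smooth := fun _ _ => smoothFunOn_zero }⟩

/-- The coordinate expression of a 1-form in a chart. -/
noncomputable def OneForm.coord (α : OneForm E M) (e : OpenPartialHomeomorph M E)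
    (y v : E) : ℝ :=
  α.toFun (e.symm y) (ofChart e y v)

/-- The coordinate expression of a 2-form in a chart. -/
noncomputable def TwoForm.coord (ω : TwoForm E M) (e : OpenPartialHomeomorph M E)
    (y v w : E) : ℝ :=
  ω.toFun (e.symm y) (ofChart e y v) (ofChart e y w)

/-- `ω` is the exterior derivative of `α`: in every chart,
`ω_y(v, w) = ∂_v (α_y(w)) - ∂_w (α_y(v))` for constant `v`, `w`. -/
def IsExtDeriv (α : OneForm E M) (ω : TwoForm E M) : Prop :=
  ∀ e ∈ atlas E M, ∀ y ∈ e.target, ∀ v w : E,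
    ω.coord e y v w =
      deriv (fun s : ℝ => α.coord e (y + s • v) w) 0 -
        deriv (fun s : ℝ => α.coord e (y + s • w) v) 0

open Classical in
/-- The exterior derivative of a 1-form: the 2-form given in every chart by the usual formula.
On a convenient manifold this 2-form always exists, and it is unique; the value `0` for lack of
one never occurs and only saves carrying an existence proof in the definition. -/
noncomputable def OneForm.extDeriv (α : OneForm E M) : TwoForm E M :=
  if h : ∃ ω, IsExtDeriv α ω then h.choose else 0

section

variable [IsTopologicalAddGroup E] [ContinuousSMul ℝ E] [T2Space E]

theorem TwoForm.eq_of_coord {ω ω' : TwoForm E M}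
    (h : ∀ e ∈ atlas E M, ∀ y ∈ e.target, ∀ v w, ω.coord e y v w = ω'.coord e y v w) :
    ω = ω' := by
  ext p v w
  have := h _ (chart_mem_atlas E p) _ (mem_chart_target E p) v w
  simp only [TwoForm.coord, ofChart_chartAt] at this
  rwa [(chartAt E p).left_inv (mem_chart_source E p)] at this

theorem IsExtDeriv.extDeriv_eq {α : OneForm E M} {ω : TwoForm E M} (h : IsExtDeriv α ω) :
    α.extDeriv = ω := by
  have hex : ∃ ω, IsExtDeriv α ω := ⟨ω, h⟩
  rw [OneForm.extDeriv, dif_pos hex]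
  exact TwoForm.eq_of_coord fun e he y hy v w =>
    (hex.choose_spec e he y hy v w).trans (h e he y hy v w).symm

theorem OneForm.mem_cotangent (α : OneForm E M) (p : M) : α.toFun p ∈ KCotangent E p := by
  intro c J hJ hc _
  have h := α.smooth _ (chart_mem_atlas E p) (fun t => (chartAt E p p, c t)) J hJ
    ((smoothCurveOn_const _ J).prodMk hc) fun t _ => ⟨mem_chart_target E p, mem_univ _⟩
  refine h.congr fun t _ => ?_
  simp only [Function.comp_apply, ofChart_chartAt]
  rw [(chartAt E p).left_inv (mem_chart_source E p)]

theorem TwoForm.mem_cotangent (ω : TwoForm E M) (p : M) (v : KTangent E p) :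
    ω.toFun p v ∈ KCotangent E p := by
  intro c J hJ hc _
  have h := ω.smooth _ (chart_mem_atlas E p) (fun t => (chartAt E p p, v, c t)) J hJ
    ((smoothCurveOn_const _ J).prodMk ((smoothCurveOn_const _ J).prodMk hc))
    fun t _ => ⟨mem_chart_target E p, mem_univ _⟩
  refine h.congr fun t _ => ?_
  simp only [Function.comp_apply, ofChart_chartAt]
  rw [(chartAt E p).left_inv (mem_chart_source E p)]

/-- The bundle morphism `v ↦ θ(v) θ + ι_v dη + η(v) η`. -/
noncomputable def flat (θ η : OneForm E M) : BundleMorphism E M where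
  toFun p :=
    { toFun := fun v =>
        ⟨θ.toFun p v • θ.toFun p + η.extDeriv.toFun p v + η.toFun p v • η.toFun p,
          Submodule.add_mem _ (Submodule.add_mem _
            (Submodule.smul_mem _ _ (θ.mem_cotangent p)) (η.extDeriv.mem_cotangent p v))
            (Submodule.smul_mem _ _ (η.mem_cotangent p))⟩
      map_add' := fun v w => by
        ext u
        simp only [map_add, LinearMap.add_apply, LinearMap.smul_apply, smul_eq_mul,
          Submodule.coe_add]
        ring
      map_smul' := fun a v => by
        ext u
        simp only [map_smul, LinearMap.add_apply, LinearMap.smul_apply, smul_eq_mul,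
          Submodule.coe_smul, RingHom.id_apply]
        ring }
  smooth := fun e he => by
    have h2 : ∀ α : OneForm E M, SmoothFunOn (fun z : E × E × E =>
        α.toFun (e.symm z.1) (ofChart e z.1 z.2.1) *
          α.toFun (e.symm z.1) (ofChart e z.1 z.2.2)) (e.target ×ˢ univ) := by
      intro α
      refine SmoothFunOn.mul ?_ ?_
      · intro c J hJ hc hU
        exact α.smooth e he (fun t => ((c t).1, (c t).2.1)) J hJ (hc.fst.prodMk hc.snd.fst)
          fun t ht => ⟨(hU ht).1, mem_univ _⟩
      · intro c J hJ hc hU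
        exact α.smooth e he (fun t => ((c t).1, (c t).2.2)) J hJ (hc.fst.prodMk hc.snd.snd)
          fun t ht => ⟨(hU ht).1, mem_univ _⟩
    exact ((h2 θ).add (η.extDeriv.smooth e he)).add (h2 η)

end

/-- The distribution `ker α`. -/
def OneForm.ker (α : OneForm E M) (p : M) : Submodule ℝ (KTangent E p) :=
  LinearMap.ker (α.toFun p)

/-- The distribution `ker ω`, the kernel of `v ↦ ι_v ω = ω(v, ·)`. -/
def TwoForm.ker (ω : TwoForm E M) (p : M) : Submodule ℝ (KTangent E p) :=
  LinearMap.ker (ω.toFun p)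

/-- `ω` is degenerate on the distribution `D`: at every point the restriction of `v ↦ ι_v ω`
to `D` has a non-zero kernel, i.e. `ker ω ∩ D ≠ 0`. -/
def TwoForm.IsDegenerateOn (ω : TwoForm E M) (D : ∀ p : M, Submodule ℝ (KTangent E p)) : Prop :=
  ∀ p, ω.ker p ⊓ D p ≠ ⊥

/-- `(D, ω|_D)` is a weakly symplectic distribution: at every point the alternating bilinear form
`ω` restricted to `D × D` is weakly non-degenerate. -/
def TwoForm.IsWeaklySymplecticOn (ω : TwoForm E M)
    (D : ∀ p : M, Submodule ℝ (KTangent E p)) : Prop :=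
  ∀ p, ((ω.toFun p).domRestrict₁₂ (D p) (D p)).SeparatingLeft

end Manifold

end Convenient

open Convenient

/-! Everything happens in a single tangent space, and each of the three conditions amounts to `V ∩
H_tz = 0`. For injectivity, pairing the image of `v` with `v` itself gives `θ(v)² + η(v)²`, so the
kernel of the morphism is exactly `V ∩ H_tz` (`ker_flat`). A weakly symplectic restriction clearly
excludes such vectors. If `V ∩ H_tz = 0`, degeneracy supplies `a ∈ V_t` and `b ∈ V_z` with `θ(a) ≠
0` and `η(b) ≠ 0`. Up to scaling they are dual to `θ, η`, hence span a complement of `H_tz`, which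
gives the splitting (`isInternal_of_inf_eq_bot`). Finally, the splitting makes `H_tz` a complement
of `V = ker dη`, and an alternating form is weakly non-degenerate on any complement of its kernel
(`separatingLeft_of_isCompl`). -/

namespace Convenient

/-! ### Linear algebra in one tangent space -/

section LinearAlgebra

variable {T : Type*} [AddCommGroup T] [Module ℝ T]

/-- If `V` meets `ker θ ⊓ ker η` trivially and both `V ⊓ ker θ` and `V ⊓ ker η` are non-zero, then
the whole space is the direct sum of these three subspaces. -/
theorem isInternal_of_inf_eq_bot {θ η : T →ₗ[ℝ] ℝ} {V : Submodule ℝ T}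
    (hV : V ⊓ (LinearMap.ker θ ⊓ LinearMap.ker η) = ⊥)
    (ht : V ⊓ LinearMap.ker θ ≠ ⊥) (hz : V ⊓ LinearMap.ker η ≠ ⊥) :
    DirectSum.IsInternal
      ![LinearMap.ker θ ⊓ LinearMap.ker η, V ⊓ LinearMap.ker η, V ⊓ LinearMap.ker θ] := by
  have key : ∀ v ∈ V, θ v = 0 → η v = 0 → v = 0 := fun v hv h1 h2 => by
    have : v ∈ V ⊓ (LinearMap.ker θ ⊓ LinearMap.ker η) := ⟨hv, h1, h2⟩
    rwa [hV, Submodule.mem_bot] at this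
  obtain ⟨b, ⟨hbV, hbθ : θ b = 0⟩, hb0⟩ := Submodule.exists_mem_ne_zero_of_ne_bot ht
  obtain ⟨a, ⟨haV, haη : η a = 0⟩, ha0⟩ := Submodule.exists_mem_ne_zero_of_ne_bot hz
  -- Otherwise `a`, and likewise `b`, would be a non-zero vector of `V ⊓ (ker θ ⊓ ker η)`.
  have haθ : θ a ≠ 0 := fun h => ha0 (key a haV h haη)
  have hbη : η b ≠ 0 := fun h => hb0 (key b hbV hbθ h)
  rw [DirectSum.isInternal_submodule_iff_iSupIndep_and_iSup_eq_top]
  constructor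
  -- For each summand, the other two lie in one common subspace `B'`: `V`, `ker θ` and `ker η` in
  -- turn. The summand meets that `B'` only inside `V ⊓ (ker θ ⊓ ker η)`.
  · have hd : ∀ {A B B' : Submodule ℝ T}, B ≤ B' → (∀ v ∈ A, v ∈ B' → v = 0) → Disjoint A B :=
      fun hB h => (Submodule.disjoint_def.2 h).mono_right hB
    intro i
    fin_cases i
    · refine hd (B' := V) (iSup₂_le fun j hj => ?_) fun v hv hvV => key v hvV hv.1 hv.2
      fin_cases j
      · exact absurd rfl hj
      · exact inf_le_left
      · exact inf_le_left
    · refine hd (B' := LinearMap.ker θ) (iSup₂_le fun j hj => ?_)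
        fun v hv hvθ => key v hv.1 hvθ hv.2
      fin_cases j
      · exact inf_le_left
      · exact absurd rfl hj
      · exact inf_le_right
    · refine hd (B' := LinearMap.ker η) (iSup₂_le fun j hj => ?_)
        fun v hv hvη => key v hv.1 hv.2 hvη
      fin_cases j
      · exact inf_le_right
      · exact inf_le_right
      · exact absurd rfl hj
  · rw [eq_top_iff]
    intro v _
    have hmem : ∀ i, ∀ x ∈ (![LinearMap.ker θ ⊓ LinearMap.ker η, V ⊓ LinearMap.ker η,
        V ⊓ LinearMap.ker θ] : Fin 3 → Submodule ℝ T) i, x ∈ iSup _ :=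
      fun i x hx => Submodule.mem_iSup_of_mem i hx
    -- Since `η a = 0` and `θ b = 0`, these coefficients make both `θ` and `η` vanish on the
    -- bracketed remainder.
    have hv : v = (v - (θ v / θ a) • a - (η v / η b) • b) + (θ v / θ a) • a + (η v / η b) • b := by
      abel
    rw [hv]
    refine Submodule.add_mem _ (Submodule.add_mem _ (hmem 0 _ ⟨?_, ?_⟩)
      (hmem 1 _ (Submodule.smul_mem _ _ ⟨haV, haη⟩)))
      (hmem 2 _ (Submodule.smul_mem _ _ ⟨hbV, hbθ⟩))
    · simp [hbθ, haθ]
    · simp [haη, hbη]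

/-- A vector of `V ⊓ (A ⊓ B)` lies in both of the independent summands `A ⊓ B` and `V ⊓ B`. -/
theorem inf_eq_bot_of_isInternal {V A B : Submodule ℝ T}
    (h : DirectSum.IsInternal ![A ⊓ B, V ⊓ B, V ⊓ A]) : V ⊓ (A ⊓ B) = ⊥ := by
  have hd : Disjoint (A ⊓ B) (V ⊓ B) :=
    h.submodule_iSupIndep.pairwiseDisjoint (i := 0) (j := 1) (by decide)
  rw [eq_bot_iff, ← hd.eq_bot]
  exact fun v hv => ⟨hv.2, hv.1, hv.2.2⟩

theorem sup_eq_top_of_isInternal {V A B : Submodule ℝ T}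
    (h : DirectSum.IsInternal ![A ⊓ B, V ⊓ B, V ⊓ A]) : V ⊔ A ⊓ B = ⊤ := by
  rw [eq_top_iff, ← h.submodule_iSup_eq_top]
  refine iSup_le fun i => ?_
  fin_cases i
  · exact le_sup_right
  · exact inf_le_left.trans le_sup_left
  · exact inf_le_left.trans le_sup_left

theorem inf_eq_bot_of_separatingLeft {ω : T →ₗ[ℝ] T →ₗ[ℝ] ℝ} {D : Submodule ℝ T}
    (h : (ω.domRestrict₁₂ D D).SeparatingLeft) : LinearMap.ker ω ⊓ D = ⊥ := by
  rw [Submodule.eq_bot_iff]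
  rintro v ⟨hv, hvD⟩
  have hv : ω v = 0 := hv
  have := h ⟨v, hvD⟩ fun w => LinearMap.congr_fun hv w.1
  exact congrArg Subtype.val this

/-- An alternating form restricts to a weakly non-degenerate form on a complement of its kernel. -/
theorem separatingLeft_of_isCompl {ω : T →ₗ[ℝ] T →ₗ[ℝ] ℝ} (hω : ω.IsAlt) {D : Submodule ℝ T}
    (h : IsCompl (LinearMap.ker ω) D) : (ω.domRestrict₁₂ D D).SeparatingLeft := by
  rintro ⟨v, hvD⟩ hv
  have hker : v ∈ LinearMap.ker ω := by
    refine LinearMap.mem_ker.2 (LinearMap.ext fun w => ?_)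
    obtain ⟨x, hx, y, hy, rfl⟩ :=
      Submodule.mem_sup.1 (h.sup_eq_top.symm ▸ Submodule.mem_top : w ∈ LinearMap.ker ω ⊔ D)
    have hx : ω x = 0 := hx
    -- The kernel only controls the left argument; antisymmetry carries it over to the right one.
    have h1 : ω v x = 0 := by rw [← hω.neg, hx]; simp
    have h2 : ω v y = 0 := hv ⟨y, hy⟩
    simp [h1, h2]
  exact Subtype.ext (Submodule.disjoint_def.1 h.disjoint v hker hvD)

end LinearAlgebra

/-! ### The kernel of the bundle morphism -/

section Flat

variable {E : Type*} [AddCommGroup E] [Module ℝ E] [TopologicalSpace E]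
  {M : Type*} [TopologicalSpace M] [ChartedSpace E M]

theorem BundleMorphism.onTotal_injective_iff {Φ : BundleMorphism E M} :
    Function.Injective Φ.onTotal ↔ ∀ p, Function.Injective (Φ.toFun p) := by
  constructor
  · intro h p v w hvw
    have : Φ.onTotal ⟨p, v⟩ = Φ.onTotal ⟨p, w⟩ := by simp only [onTotal, hvw]
    exact eq_of_heq (Sigma.mk.inj (h this)).2
  · rintro h ⟨p, v⟩ ⟨q, w⟩ hvw
    obtain ⟨rfl, h2⟩ := Sigma.mk.inj hvw
    exact congrArg (Sigma.mk p) (h p (eq_of_heq h2))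

variable [IsTopologicalAddGroup E] [ContinuousSMul ℝ E] [T2Space E]

/-- Evaluating the image of `v` at `v` kills the alternating term and leaves a sum of two real
squares, so both vanish; what remains of the functional is `ι_v dη`. -/
theorem ker_flat (θ η : OneForm E M) (p : M) :
    LinearMap.ker ((flat θ η).toFun p) = η.extDeriv.ker p ⊓ (θ.ker p ⊓ η.ker p) := by
  have happ : ∀ v w : KTangent E p, ((flat θ η).toFun p v).1 w =
      θ.toFun p v * θ.toFun p w + η.extDeriv.toFun p v w + η.toFun p v * η.toFun p w :=
    fun _ _ => rfl
  ext v
  constructor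
  · intro hv
    have hv : (flat θ η).toFun p v = 0 := hv
    have h0 : ∀ w, θ.toFun p v * θ.toFun p w + η.extDeriv.toFun p v w +
        η.toFun p v * η.toFun p w = 0 := fun w => by rw [← happ, hv]; rfl
    have hvv := h0 v
    rw [η.extDeriv.alternating] at hvv
    have hθ : θ.toFun p v = 0 := by nlinarith
    have hη : η.toFun p v = 0 := by nlinarith
    refine ⟨LinearMap.ext fun w => ?_, hθ, hη⟩
    simpa [hθ, hη] using h0 w
  · rintro ⟨hω, hθ, hη⟩
    have hω : η.extDeriv.toFun p v = 0 := hω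
    have hθ : θ.toFun p v = 0 := hθ
    have hη : η.toFun p v = 0 := hη
    refine LinearMap.mem_ker.2 (Subtype.ext (LinearMap.ext fun w => ?_))
    rw [happ, hω, hθ, hη]
    simp

theorem flat_injective_iff (θ η : OneForm E M) :
    Function.Injective (flat θ η).onTotal ↔
      ∀ p, η.extDeriv.ker p ⊓ (θ.ker p ⊓ η.ker p) = ⊥ := by
  rw [BundleMorphism.onTotal_injective_iff]
  refine forall_congr' fun p => ?_
  rw [← ker_flat]
  rw [injective_iff_map_eq_zero, Submodule.eq_bot_iff]
  rfl

end Flat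

end Convenient

/-! ### The equivalence -/

theorem mainTheorem7 {E : Type*} [AddCommGroup E] [Module ℝ E] [TopologicalSpace E]
    [ConvenientSpace E] {M : Type*} [TopologicalSpace M] [ChartedSpace E M]
    [ConvenientManifold E M] (θ η : OneForm E M) (hθ : θ.extDeriv = 0)
    (hdeg_t : η.extDeriv.IsDegenerateOn θ.ker)
    (hdeg_z : η.extDeriv.IsDegenerateOn η.ker) :
    List.TFAE [
      ∀ p : M, DirectSum.IsInternal
        ![θ.ker p ⊓ η.ker p, η.extDeriv.ker p ⊓ η.ker p, η.extDeriv.ker p ⊓ θ.ker p],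
      η.extDeriv.IsWeaklySymplecticOn (fun p => θ.ker p ⊓ η.ker p),
      Function.Injective (flat θ η).onTotal] := by
  tfae_have 1 → 2 := fun h p =>
    separatingLeft_of_isCompl (η.extDeriv.alternating p)
      ⟨disjoint_iff.2 (inf_eq_bot_of_isInternal (h p)),
        codisjoint_iff.2 (sup_eq_top_of_isInternal (h p))⟩
  tfae_have 2 → 3 := fun h =>
    (flat_injective_iff θ η).2 fun p => inf_eq_bot_of_separatingLeft (h p)
  -- Only this implication needs the degeneracy assumptions, which provide the vectors of `V_z` and
  -- `V_t`.
  tfae_have 3 → 1 := fun h p =>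
    isInternal_of_inf_eq_bot ((flat_injective_iff θ η).1 h p) (hdeg_t p) (hdeg_z p)
  tfae_finish
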